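/- Let $K$ be a field, $N$ a positive integer, $E\in\{2,3,\dots,\lfloor N/2\rfloor-1\}$, and let $x_1,\dots,x_N\in K$ be distinct nodes with values $y_1,\dots,y_N\in K$. Put $W(x)=\prod_{j=1}^N(x-x_j)$ and $$\widetilde\tau_k=\sum_{j=1}^N\frac1{y_j}\,\frac{x_j^k}{W'(x_j)}\qquad(k=0,1,2,\dots).$$ For a sequence $c=(c_0,c_1,\dots)$ in $K$ let $\mathcal H_k(x;\{c\})$, the $k$-th Hankel polynomial, be the determinant of the $(k+1)\times(k+1)$ matrix whose first $k$ rows are $(c_i,c_{i+1},\dots,c_{i+k})$, $i=0,\dots,k-1$, and whose last row is $(1,x,\dots,x^k)$. Let $p(x)=p_0x^n+\dots+p_n\in K[x]$, $p_0\neq0$, be a polynomial of degree $n<N-2E$, and let $e_1,\dots,e_E\in\{1,\dots,N\}$ be distinct indices. Suppose that (a) $y_j\neq0$ for all $j\in\{1,\dots,N\}$; (b) $y_j=p(x_j)$ for all $j\in\{1,\dots,N\}\setminus\{e_1,\dots,e_E\}$; (c) $\widehat y_{e_s}:=p(x_{e_s})\neq y_{e_s}$ and $\widehat y_{e_s}\neq0$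 for all $s\in\{1,\dots,E\}$. Then $$\mathcal H_{n+E}(x;\{\widetilde\tau\})\equiv(-1)^{nN+n(n+1)/2+E}\,p_0^{\,N-n-2E-1}\,\frac{\prod_{s=1}^E(y_{e_s}-\widehat y_{e_s})\prod_{1\le s<t\le E}(x_{e_t}-x_{e_s})^2}{\prod_{s=1}^EW'(x_{e_s})\prod_{j=1}^Ny_j}\;p(x)\prod_{s=1}^E(x-x_{e_s}).$$ If $n<N-2E-1$, then $$\mathcal H_{N-E-1}(x;\{\widetilde\tau\})\equiv\frac{(-1)^{E+(N-n)(N-n-1)/2}}{p_0^{\,N-n-2E-1}}\,\mathcal H_{n+E}(x;\{\widetilde\tau\}).$$ If $n<N-2E-2$, then $\mathcal H_k(x;\{\widetilde\tau\})\equiv0$ for every $k$ with $n+E+1\le k\le N-E-2$. -/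

import Mathlib

open Polynomial

/-- The `k`-th Hankel polynomial generated by the sequence `c`: the determinant of the
`(k + 1) × (k + 1)` matrix whose rows `i = 0, …, k - 1` are `c_i, c_{i+1}, …, c_{i+k}` and whose
last row is `1, X, …, X ^ k`. -/
noncomputable def hankelPoly {K : Type*} [Field K] (c : ℕ → K) (k : ℕ) : K[X] :=
  Matrix.det (Matrix.of fun i j : Fin (k + 1) =>
    if (i : ℕ) < k then C (c ((i : ℕ) + (j : ℕ))) else X ^ (j : ℕ))

/-- The polynomial `W(X) = ∏ j, (X - x_j)` of the nodes. -/
noncomputable def nodePoly {K : Type*} [Field K] {N : ℕ} (x : Fin N → K) : K[X] :=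
  ∏ j, (X - C (x j))

/-- The value `W'(x_j)` of the formal derivative of `W` at the node `x_j`. -/
noncomputable def nodeDeriv {K : Type*} [Field K] {N : ℕ} (x : Fin N → K) (j : Fin N) : K :=
  (derivative (nodePoly x)).eval (x j)

/-- The sequence `τ̃_k = ∑ j, (1 / y_j) * (x_j ^ k / W'(x_j))`. -/
noncomputable def tauTilde {K : Type*} [Field K] {N : ℕ} (x y : Fin N → K) (k : ℕ) : K :=
  ∑ j, (1 / y j) * (x j ^ k / nodeDeriv x j)

/-! ### Block-triangular and antitriangular determinants. -/

section Determinants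

variable {R : Type*} [CommRing R]

/-! Let `L f = ∑ j, f(x_j) / (y_j W'(x_j))`, so that `τ̃_k = L (X ^ k)`, and let `q = p Λ` with `Λ =
∏ s, (X - x_{e_s})`. As `Λ` vanishes at the corrupted nodes and `p = y` at the others, `L (f q) = ∑
j, (f Λ)(x_j) / W'(x_j)`. By Lagrange interpolation this is the coefficient of `X ^ (N - 1)` in `f
Λ` when `deg (f Λ) < N`. Hence `L (X ^ k q)` is `0` for `k < N - E - 1` and `1` for `k = N - E - 1`
(`weightedEval_X_pow_mul_locator`).

Column operations replacing `X ^ (n + E + j)` by `X ^ j q` then make the Hankel matrix of order `n +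
E + c` block triangular with an antitriangular corner (`hankelPoly_mul_leadingCoeff_pow`). The
corner contributes `q` times the `c`-th power of `L (X ^ (n + E + c) q)`, so one identity gives all
three claims.

The constant is a Gram determinant of `L` of order `n + E` (`det_weightedEval_inv_corrupted`). There
`L` is the functional with weights `1 / (p(x_j) W'(x_j))` plus `E` point evaluations, and a
congruence separates the two contributions. -/

theorem det_eq_mul_of_castAdd_natAdd_eq_zero {a b : ℕ} (M : Matrix (Fin (a + b)) (Fin (a + b)) R)
    (h : ∀ i j, M (Fin.castAdd b i) (Fin.natAdd a j) = 0) :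
    M.det = (M.submatrix (Fin.castAdd b) (Fin.castAdd b)).det *
      (M.submatrix (Fin.natAdd a) (Fin.natAdd a)).det := by
  rw [← Matrix.det_submatrix_equiv_self finSumFinEquiv M,
    ← Matrix.det_fromBlocks_zero₁₂ _ (M.submatrix (Fin.natAdd a) (Fin.castAdd b))]
  congr 1
  ext i j
  rcases i with i | i <;> rcases j with j | j <;> simp [h]

/-- The determinant of a matrix vanishing above its antidiagonal. -/
theorem det_eq_of_antitriangular (c : ℕ) (M : Matrix (Fin c) (Fin c) R)
    (h : ∀ i j : Fin c, (i : ℕ) + j + 1 < c → M i j = 0) :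
    M.det = (-1) ^ (c * (c - 1) / 2) * ∏ i, M i i.rev := by
  induction c with
  | zero => simp
  | succ c ih =>
    rw [Matrix.det_succ_row_zero, Finset.sum_eq_single (Fin.last c)]
    · rw [ih]
      · rw [Fin.prod_univ_succ]
        have hc : (c + 1) * (c + 1 - 1) / 2 = c + c * (c - 1) / 2 := by
          rw [← Finset.sum_range_id_mul_two, ← Finset.sum_range_id_mul_two c,
            Nat.mul_div_cancel _ two_pos, Nat.mul_div_cancel _ two_pos, Finset.sum_range_succ,
            add_comm]
        have hM : ∀ i : Fin c, M i.succ ((Fin.last c).succAbove i.rev) = M i.succ i.succ.rev := by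
          intro i
          congr 1
          rw [Fin.succAbove_last, Fin.rev_succ]
        simp only [Matrix.submatrix_apply, hM, hc, Fin.val_last, pow_add, Fin.rev_zero]
        ring
      · intro i j hij
        refine h _ _ ?_
        simp
        omega
    · intro j _ hj
      rw [h 0 j, mul_zero, zero_mul]
      have := Fin.val_lt_last hj
      simp
      omega
    · simp

end Determinants

/-! ### Triangular change of polynomial basis. -/

section StepBasis

variable {K : Type*} [Field K]

/-- The polynomials `1, X, …, X ^ (d - 1), q, X * q, X ^ 2 * q, …`. -/
noncomputable def stepBasis (d : ℕ) (q : K[X]) (j : ℕ) : K[X] :=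
  if j < d then X ^ j else X ^ (j - d) * q

theorem stepBasis_of_lt {d j : ℕ} (q : K[X]) (h : j < d) : stepBasis d q j = X ^ j := if_pos h

theorem stepBasis_add (d j : ℕ) (q : K[X]) : stepBasis d q (d + j) = X ^ j * q := by
  simp [stepBasis]

theorem natDegree_stepBasis_le {d : ℕ} {q : K[X]} (hq : q.natDegree = d) (j : ℕ) :
    (stepBasis d q j).natDegree ≤ j := by
  rw [stepBasis]
  split_ifs with h
  · exact natDegree_X_pow_le j
  · refine natDegree_mul_le.trans ?_
    rw [natDegree_X_pow]
    omega

theorem prod_coeff_stepBasis {d : ℕ} {q : K[X]} (hq : q.natDegree = d) (c : ℕ) :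
    ∏ j : Fin (d + c), (stepBasis d q j).coeff j = q.leadingCoeff ^ c := by
  rw [Fin.prod_univ_add]
  have h₁ : ∀ i : Fin d, (stepBasis d q (Fin.castAdd c i)).coeff (Fin.castAdd c i : ℕ) = 1 := by
    intro i
    rw [stepBasis_of_lt _ (by simp)]
    simp
  have h₂ : ∀ i : Fin c,
      (stepBasis d q (Fin.natAdd d i)).coeff (Fin.natAdd d i : ℕ) = q.leadingCoeff := by
    intro i
    rw [Fin.val_natAdd, stepBasis_add, coeff_X_pow_mul, leadingCoeff, hq]
  rw [Finset.prod_congr rfl fun i _ => h₁ i, Finset.prod_congr rfl fun i _ => h₂ i]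
  simp

/-- The coefficient matrix of `b` is upper triangular. Values in an algebra `R` allow the rows of a
Hankel polynomial, scalar except for the last, to be treated uniformly over `K[X]`. -/
theorem det_linear_of_natDegree_le {R : Type*} [CommRing R] [Algebra K R] {m : ℕ}
    (φ : Fin m → K[X] →ₗ[K] R) (b : ℕ → K[X]) (hb : ∀ j, (b j).natDegree ≤ j) :
    (Matrix.of fun i j : Fin m => φ i (b j)).det =
      (Matrix.of fun i j : Fin m => φ i (X ^ (j : ℕ))).det *
        algebraMap K R (∏ j : Fin m, (b j).coeff j) := by
  have hU : (Matrix.of fun i j : Fin m => algebraMap K R ((b j).coeff i)).det =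
      algebraMap K R (∏ j : Fin m, (b j).coeff j) := by
    rw [Matrix.det_of_isUpperTriangular, map_prod]
    · rfl
    · intro i j hij
      rw [Matrix.of_apply, coeff_eq_zero_of_natDegree_lt, map_zero]
      exact (hb j).trans_lt hij
  rw [← hU, ← Matrix.det_mul]
  congr 1
  ext i j
  rw [Matrix.mul_apply, Matrix.of_apply,
    (b j).as_sum_range' m ((hb j).trans_lt j.2), map_sum,
    ← Fin.sum_univ_eq_sum_range (fun k => φ i (monomial k ((b j).coeff k)))]
  refine Finset.sum_congr rfl fun k _ => ?_
  simp only [Matrix.of_apply]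
  rw [← C_mul_X_pow_eq_monomial, ← smul_eq_C_mul, map_smul, Algebra.smul_def, mul_comm]

theorem det_linear_stepBasis {R : Type*} [CommRing R] [Algebra K R] {d c : ℕ}
    (φ : Fin (d + c) → K[X] →ₗ[K] R) {q : K[X]} (hq : q.natDegree = d) :
    (Matrix.of fun i j : Fin (d + c) => φ i (stepBasis d q j)).det =
      (Matrix.of fun i j : Fin (d + c) => φ i (X ^ (j : ℕ))).det *
        algebraMap K R (q.leadingCoeff ^ c) := by
  rw [det_linear_of_natDegree_le φ _ (natDegree_stepBasis_le hq), prod_coeff_stepBasis hq]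

end StepBasis

/-! ### Moments of weighted sums over the nodes. -/

section WeightedEval

variable {K : Type*} [Field K] {N : ℕ}

/-- The functional `f ↦ ∑ j, w j * f (x j)`. -/
noncomputable def weightedEval (w x : Fin N → K) : K[X] →ₗ[K] K := ∑ j, w j • leval (x j)

theorem weightedEval_apply (w x : Fin N → K) (f : K[X]) :
    weightedEval w x f = ∑ j, w j * f.eval (x j) := by
  simp [weightedEval]

/-- Used to cancel the denominator of a weight against a factor of the argument, leaving the weights
`1 / W'(x_j)`. -/
theorem weightedEval_mul_of_eq {w w' x : Fin N → K} {q g : K[X]}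
    (h : ∀ j, w j * q.eval (x j) = w' j * g.eval (x j)) (f : K[X]) :
    weightedEval w x (f * q) = weightedEval w' x (f * g) := by
  rw [weightedEval_apply, weightedEval_apply]
  refine Finset.sum_congr rfl fun j _ => ?_
  rw [eval_mul, eval_mul, mul_left_comm, h, mul_left_comm]

theorem nodeDeriv_eq (x : Fin N → K) (j : Fin N) :
    nodeDeriv x j = ∏ i ∈ Finset.univ.erase j, (x j - x i) := by
  rw [nodeDeriv, nodePoly, ← Lagrange.nodal_eq,
    Lagrange.eval_nodal_derivative_eval_node_eq (Finset.mem_univ j), Lagrange.eval_nodal]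

theorem nodeDeriv_ne_zero {x : Fin N → K} (hx : Function.Injective x) (j : Fin N) :
    nodeDeriv x j ≠ 0 := by
  rw [nodeDeriv_eq, Finset.prod_ne_zero_iff]
  intro i hi h
  exact (Finset.ne_of_mem_erase hi) (hx (sub_eq_zero.1 h)).symm

/-- The sum is the top coefficient of the Lagrange interpolant of `f`, which is `f` itself. -/
theorem weightedEval_inv_nodeDeriv {x : Fin N → K} (hx : Function.Injective x) {f : K[X]}
    (hf : f.natDegree < N) :
    weightedEval (fun j => (nodeDeriv x j)⁻¹) x f = f.coeff (N - 1) := by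
  have h := Lagrange.coeff_eq_sum (s := Finset.univ) (v := x) hx.injOn (P := f)
    (by rw [Finset.card_univ, Fintype.card_fin]
        exact degree_le_natDegree.trans_lt (by exact_mod_cast hf))
  rw [Finset.card_univ, Fintype.card_fin] at h
  rw [h, weightedEval_apply]
  refine Finset.sum_congr rfl fun j _ => ?_
  rw [nodeDeriv_eq, div_eq_inv_mul]

theorem det_weightedEval_pow (w x : Fin N → K) :
    (Matrix.of fun i j : Fin N => weightedEval w x (X ^ (i : ℕ) * X ^ (j : ℕ))).det =
      (Matrix.vandermonde x).det ^ 2 * ∏ j, w j := by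
  have h : (Matrix.of fun i j : Fin N => weightedEval w x (X ^ (i : ℕ) * X ^ (j : ℕ))) =
      (Matrix.vandermonde x).transpose * Matrix.diagonal w * Matrix.vandermonde x := by
    ext i j
    rw [Matrix.mul_apply, Matrix.of_apply, weightedEval_apply]
    refine Finset.sum_congr rfl fun k _ => ?_
    rw [Matrix.mul_diagonal]
    simp
    ring
  rw [h, Matrix.det_mul, Matrix.det_mul, Matrix.det_transpose, Matrix.det_diagonal]
  ring

theorem weightedEval_inv_nodeDeriv_X_pow {x : Fin N → K} (hx : Function.Injective x) {k : ℕ}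
    (hk : k < N) :
    weightedEval (fun j => (nodeDeriv x j)⁻¹) x (X ^ k) = if k + 1 = N then 1 else 0 := by
  rw [weightedEval_inv_nodeDeriv hx (by simpa using hk), coeff_X_pow]
  exact if_congr (by omega) rfl rfl

/-- For the weights `1 / W'(x_j)` the Gram matrix of monomials is antitriangular with ones on the
antidiagonal. -/
theorem det_vandermonde_sq_mul_prod_inv_nodeDeriv {x : Fin N → K} (hx : Function.Injective x) :
    (Matrix.vandermonde x).det ^ 2 * ∏ j, (nodeDeriv x j)⁻¹ = (-1) ^ (N * (N - 1) / 2) := by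
  rw [← det_weightedEval_pow, det_eq_of_antitriangular]
  · rw [Finset.prod_eq_one, mul_one]
    intro i _
    rw [Matrix.of_apply, ← pow_add, weightedEval_inv_nodeDeriv_X_pow hx, if_pos]
    all_goals rw [Fin.val_rev]; omega
  · intro i j hij
    rw [Matrix.of_apply, ← pow_add, weightedEval_inv_nodeDeriv_X_pow hx (by omega),
      if_neg (by omega)]

/-- The Hankel determinant of order `deg p` of the moments of the uncorrupted weights
`1 / (p (x j) * W' (x j))`. -/
theorem det_weightedEval_inv_eval {n c : ℕ} (hN : N = n + c) {x : Fin N → K}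
    (hx : Function.Injective x) {p : K[X]} (hp : p.natDegree = n)
    (hpx : ∀ j, p.eval (x j) ≠ 0) :
    (Matrix.of fun i j : Fin n =>
      weightedEval (fun j => (p.eval (x j) * nodeDeriv x j)⁻¹) x (X ^ (i : ℕ) * X ^ (j : ℕ))).det =
      (-1) ^ (N * (N - 1) / 2) * (-1) ^ (c * (c - 1) / 2) * p.leadingCoeff ^ c *
        (∏ j, p.eval (x j))⁻¹ := by
  subst hN
  set w : Fin (n + c) → K := fun j => (p.eval (x j) * nodeDeriv x j)⁻¹ with hw
  have hred : ∀ f, weightedEval w x (f * p) =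
      weightedEval (fun j => (nodeDeriv x j)⁻¹) x (f * 1) := fun f =>
    weightedEval_mul_of_eq (fun j => by
      have := hpx j
      simp only [hw, eval_one, mul_inv]
      field_simp) f
  -- The full Gram matrix of order `N` has a known determinant. Replacing its last `c` columns by
  -- multiples of `p` isolates the block of order `n`.
  have h₁ := det_linear_stepBasis (c := c)
    (fun i : Fin (n + c) => (weightedEval w x).comp (LinearMap.mulLeft K (X ^ (i : ℕ)))) hp
  simp only [LinearMap.comp_apply, LinearMap.mulLeft_apply, Algebra.algebraMap_self_apply] at h₁
  rw [det_weightedEval_pow, det_eq_mul_of_castAdd_natAdd_eq_zero] at h₁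
  · rw [det_eq_of_antitriangular c, Finset.prod_eq_one, mul_one] at h₁
    · have h₂ : ((Matrix.of fun i j : Fin (n + c) =>
          weightedEval w x (X ^ (i : ℕ) * stepBasis n p j)).submatrix
            (Fin.castAdd c) (Fin.castAdd c)) = Matrix.of fun i j : Fin n =>
              weightedEval w x (X ^ (i : ℕ) * X ^ (j : ℕ)) := by
        ext i j
        simp [stepBasis_of_lt]
      have h₃ : ∏ j, w j = (∏ j, p.eval (x j))⁻¹ * ∏ j, (nodeDeriv x j)⁻¹ := by
        simp only [hw, mul_inv, Finset.prod_mul_distrib, Finset.prod_inv_distrib]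
      have h₄ : ((-1 : K) ^ (c * (c - 1) / 2)) * (-1) ^ (c * (c - 1) / 2) = 1 := by
        rw [← mul_pow]; simp
      rw [h₂, h₃] at h₁
      have h₅ := det_vandermonde_sq_mul_prod_inv_nodeDeriv hx
      linear_combination (-1) ^ (c * (c - 1) / 2) * h₁ +
        (-1) ^ (c * (c - 1) / 2) * p.leadingCoeff ^ c * (∏ j, p.eval (x j))⁻¹ * h₅ -
        h₄ * (Matrix.of fun i j : Fin n =>
              weightedEval w x (X ^ (i : ℕ) * X ^ (j : ℕ))).det
    · intro i _
      simp only [Matrix.submatrix_apply, Matrix.of_apply, Fin.val_natAdd, stepBasis_add]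
      rw [← mul_assoc, hred, mul_one, ← pow_add, weightedEval_inv_nodeDeriv_X_pow hx, if_pos]
      all_goals rw [Fin.val_rev]; omega
    · intro i j hij
      simp only [Matrix.submatrix_apply, Matrix.of_apply, Fin.val_natAdd, stepBasis_add]
      rw [← mul_assoc, hred, mul_one, ← pow_add, weightedEval_inv_nodeDeriv_X_pow hx (by omega),
        if_neg (by omega)]
  · intro i j
    simp only [Matrix.of_apply, Fin.val_natAdd, stepBasis_add, Fin.val_castAdd]
    rw [← mul_assoc, hred, mul_one, ← pow_add, weightedEval_inv_nodeDeriv_X_pow hx (by omega),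
      if_neg (by omega)]

end WeightedEval

/-! ### Gram determinants perturbed by point evaluations. -/

section Perturbation

variable {K : Type*} [Field K]

/-- Perturbing a functional whose Gram matrix on polynomials of degree less than `n + E` has the
multiples of `p` in its radical by `E` point evaluations. -/
theorem det_add_pointEvaluations {n E : ℕ} {L L₀ : K[X] →ₗ[K] K} {δ z : Fin E → K} {p : K[X]}
    (hp : p.natDegree = n) (hL : ∀ f, L f = L₀ f + ∑ s, δ s * f.eval (z s))
    (h₀ : ∀ k, k + 1 < n + 2 * E → L₀ (X ^ k * p) = 0)
    (h₁ : ∀ k l, k < E → l < E → L₀ (X ^ k * p * (X ^ l * p)) = 0) :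
    (Matrix.of fun i j : Fin (n + E) => L (X ^ (i : ℕ) * X ^ (j : ℕ))).det *
        p.leadingCoeff ^ (2 * E) =
      (Matrix.of fun i j : Fin n => L₀ (X ^ (i : ℕ) * X ^ (j : ℕ))).det * (∏ s, δ s) *
        (∏ s, p.eval (z s)) ^ 2 * (Matrix.vandermonde z).det ^ 2 := by
  have e₁ := det_linear_stepBasis (c := E)
    (fun i : Fin (n + E) => L.comp (LinearMap.mulLeft K (X ^ (i : ℕ)))) hp
  have e₂ := det_linear_stepBasis (c := E)
    (fun i : Fin (n + E) => L.comp (LinearMap.mulLeft K (stepBasis n p i))) hp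
  simp only [LinearMap.comp_apply, LinearMap.mulLeft_apply, Algebra.algebraMap_self_apply] at e₁ e₂
  have e₃ : (Matrix.of fun i j : Fin (n + E) => L (stepBasis n p i * X ^ (j : ℕ))).det =
      (Matrix.of fun i j : Fin (n + E) => L (X ^ (i : ℕ) * stepBasis n p j)).det := by
    rw [← Matrix.det_transpose]
    congr 1
    ext i j
    simp [mul_comm]
  rw [e₃, e₁, mul_assoc, ← pow_add, ← two_mul] at e₂
  rw [← e₂, ← Matrix.det_submatrix_equiv_self finSumFinEquiv]
  set H : Matrix (Fin n) (Fin n) K := Matrix.of fun i j => L₀ (X ^ (i : ℕ) * X ^ (j : ℕ)) with hH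
  set Z₁ : Matrix (Fin E) (Fin n) K := Matrix.of fun s j => z s ^ (j : ℕ) with hZ₁
  set Z₂ : Matrix (Fin E) (Fin E) K :=
    Matrix.of fun s j => p.eval (z s) * Matrix.vandermonde z s j with hZ₂
  -- In the step basis the Gram matrix of `L₀` is `H` bordered by zeros. The rows of `(Z₁ Z₂)` are
  -- the values of the step basis at the points `z s`, so the evaluations add a rank-one term each.
  have key : ((Matrix.of fun i j : Fin (n + E) =>
        L (stepBasis n p i * stepBasis n p j)).submatrix finSumFinEquiv finSumFinEquiv) =
      (Matrix.fromBlocks 1 0 Z₁ Z₂).transpose * Matrix.fromBlocks H 0 0 (Matrix.diagonal δ) *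
        Matrix.fromBlocks 1 0 Z₁ Z₂ := by
    rw [Matrix.fromBlocks_transpose, Matrix.fromBlocks_multiply, Matrix.fromBlocks_multiply]
    ext i j
    rcases i with i | i <;> rcases j with j | j
    · simp [stepBasis_of_lt, hL, Matrix.mul_apply, Matrix.diagonal_apply, hH, hZ₁]
      refine Finset.sum_congr rfl fun s _ => by ring
    · have := h₀ (i + j) (by omega)
      rw [pow_add, mul_assoc] at this
      simp [stepBasis_of_lt, stepBasis_add, hL, Matrix.mul_apply, Matrix.diagonal_apply, hZ₁, hZ₂, this]
      refine Finset.sum_congr rfl fun s _ => by ring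
    · have := h₀ (j + i) (by omega)
      rw [pow_add, mul_assoc, mul_comm] at this
      simp [stepBasis_of_lt, stepBasis_add, hL, Matrix.mul_apply, Matrix.diagonal_apply, hZ₁, hZ₂, this]
      refine Finset.sum_congr rfl fun s _ => by ring
    · have := h₁ i j i.2 j.2
      simp [stepBasis_add, hL, Matrix.mul_apply, Matrix.diagonal_apply, hZ₂, this]
      refine Finset.sum_congr rfl fun s _ => by ring
  rw [key, Matrix.det_mul, Matrix.det_mul, Matrix.det_transpose, Matrix.det_fromBlocks_zero₁₂,
    Matrix.det_fromBlocks_zero₁₂, hZ₂, Matrix.det_mul_column, Matrix.det_diagonal,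
    Matrix.det_one]
  ring

end Perturbation

/-! ### Hankel polynomials from an orthogonal polynomial. -/

section HankelPolynomial

variable {K : Type*} [Field K]

/-- Hankel polynomials of the moments of a functional `L` of order `a + c`, when `q` of degree `a`
is orthogonal to all polynomials of degree less than `a + c`. -/
theorem hankelPoly_mul_leadingCoeff_pow {a c : ℕ} {L : K[X] →ₗ[K] K} {τ : ℕ → K} {q : K[X]}
    (hτ : ∀ k, τ k = L (X ^ k)) (hq : q.natDegree = a)
    (h₀ : ∀ k < a + c, L (X ^ k * q) = 0) :
    hankelPoly τ (a + c) * C (q.leadingCoeff ^ (c + 1)) =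
      C ((Matrix.of fun i j : Fin a => L (X ^ (i : ℕ) * X ^ (j : ℕ))).det *
        ((-1) ^ ((c + 1) * c / 2) * L (X ^ (a + c) * q) ^ c)) * q := by
  -- Each row is a functional applied to the monomials: a moment embedded as a constant, or the
  -- identity in the last row.
  set φ : Fin (a + (c + 1)) → K[X] →ₗ[K] K[X] := fun i =>
    if (i : ℕ) < a + c then
      (Algebra.linearMap K K[X]).comp (L.comp (LinearMap.mulLeft K (X ^ (i : ℕ))))
    else LinearMap.id with hφ
  have φ_lt : ∀ (i : Fin (a + (c + 1))) f, (i : ℕ) < a + c → φ i f = C (L (X ^ (i : ℕ) * f)) := by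
    intro i f hi
    simp [hφ, hi, algebraMap_eq]
  have φ_last : ∀ (i : Fin (a + (c + 1))) f, ¬ (i : ℕ) < a + c → φ i f = f := by
    intro i f hi
    simp [hφ, hi]
  have h₁ := det_linear_stepBasis φ hq
  have h₂ : (Matrix.of fun i j : Fin (a + (c + 1)) => φ i (X ^ (j : ℕ))).det =
      hankelPoly τ (a + c) := by
    rw [hankelPoly]
    congr 1
    ext1 i j
    rw [Matrix.of_apply, Matrix.of_apply]
    split_ifs with hi
    · rw [φ_lt _ _ hi, hτ, pow_add]
    · rw [φ_last _ _ hi]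
  rw [h₂, algebraMap_eq] at h₁
  rw [← h₁, det_eq_mul_of_castAdd_natAdd_eq_zero, det_eq_of_antitriangular (c + 1)]
  · have h₃ : ((Matrix.of fun i j : Fin (a + (c + 1)) => φ i (stepBasis a q j)).submatrix
        (Fin.castAdd (c + 1)) (Fin.castAdd (c + 1))) =
        (C : K →+* K[X]).mapMatrix
          (Matrix.of fun i j : Fin a => L (X ^ (i : ℕ) * X ^ (j : ℕ))) := by
      ext1 i j
      simp only [Matrix.submatrix_apply, Matrix.of_apply, RingHom.mapMatrix_apply, Matrix.map_apply]
      rw [φ_lt _ _ (by simp; omega), stepBasis_of_lt _ (by simp)]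
      rfl
    -- The antidiagonal of the corner has `c` equal moments; its remaining entry, in the last row,
    -- is `q`.
    have h₄ : ∀ i : Fin c, φ (Fin.natAdd a i.castSucc)
        (stepBasis a q (Fin.natAdd a i.castSucc.rev)) = C (L (X ^ (a + c) * q)) := by
      intro i
      rw [φ_lt _ _ (by simp), Fin.val_natAdd, Fin.val_natAdd, stepBasis_add, ← mul_assoc, ← pow_add]
      congr 4
      simp
    rw [h₃, ← RingHom.map_det, Fin.prod_univ_castSucc]
    simp only [Matrix.submatrix_apply, Matrix.of_apply, h₄]
    rw [φ_last _ _ (by simp), Fin.val_natAdd, stepBasis_add]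
    simp
    ring
  · intro i j hij
    simp only [Matrix.submatrix_apply, Matrix.of_apply]
    rw [φ_lt _ _ (by simp; omega), Fin.val_natAdd, Fin.val_natAdd, stepBasis_add, ← mul_assoc,
      ← pow_add, h₀ _ (by omega), C_0]
  · intro i j
    rw [Matrix.of_apply, φ_lt _ _ (by simp; omega), Fin.val_natAdd, stepBasis_add, ← mul_assoc,
      ← pow_add, h₀ _ (by simp; omega), C_0]

end HankelPolynomial

/-! ### Parity of sign exponents. -/

section Signs

theorem neg_one_pow_eq_of_mod_two {R : Type*} [Ring R] {a b : ℕ} (h : a % 2 = b % 2) :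
    (-1 : R) ^ a = (-1) ^ b := by
  rw [neg_one_pow_eq_pow_mod_two, h, ← neg_one_pow_eq_pow_mod_two]

theorem mul_pred_div_two_add (n m : ℕ) :
    (n + m) * (n + m - 1) / 2 = n * (n - 1) / 2 + m * (m - 1) / 2 + n * m := by
  obtain ⟨t, ht⟩ := (Nat.even_mul_pred_self m).two_dvd
  obtain ⟨u, hu⟩ := (Nat.even_mul_pred_self n).two_dvd
  have h : (n + m) * (n + m - 1) = 2 * (u + t + n * m) := by
    rcases n with _ | n
    · simp_all
    rcases m with _ | m
    · simp_all
    have : n + 1 + (m + 1) - 1 = n + m + 1 := by omega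
    rw [this]
    simp only [Nat.add_sub_cancel] at ht hu
    nlinarith
  rw [h, ht, hu]
  simp

end Signs

/-! ### The error locator and the normalizing constant. -/

section ErrorLocator

variable {K : Type*} [Field K] {N E : ℕ}

theorem tauTilde_eq (x y : Fin N → K) (k : ℕ) :
    tauTilde x y k = weightedEval (fun j => (y j * nodeDeriv x j)⁻¹) x (X ^ k) := by
  rw [tauTilde, weightedEval_apply]
  refine Finset.sum_congr rfl fun j _ => ?_
  rw [eval_pow, eval_X, mul_inv, one_div, div_eq_inv_mul, mul_assoc]

theorem natDegree_prod_X_sub_C (z : Fin E → K) : (∏ s, (X - C (z s))).natDegree = E := by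
  rw [natDegree_prod_of_monic _ _ fun _ _ => monic_X_sub_C _]
  simp

/-- At corrupted nodes the locator vanishes; elsewhere `p` cancels `1 / y_j`. What remains is the
coefficient of `X ^ (N - 1)` in a monic polynomial of degree `k + E`. -/
theorem weightedEval_X_pow_mul_locator {x y : Fin N → K} (hx : Function.Injective x) {p : K[X]}
    {e : Fin E → Fin N} (ha : ∀ j, y j ≠ 0)
    (hb : ∀ j, j ∉ Set.range e → y j = p.eval (x j)) {k : ℕ} (hk : k + E < N) :
    weightedEval (fun j => (y j * nodeDeriv x j)⁻¹) x
        (X ^ k * (p * ∏ s, (X - C (x (e s))))) = if k + E + 1 = N then 1 else 0 := by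
  have hm := monic_prod_X_sub_C (fun s => x (e s)) Finset.univ
  have hd := natDegree_prod_X_sub_C fun s => x (e s)
  set q := ∏ s, (X - C (x (e s))) with hq
  have hdk : (X ^ k * q).natDegree = k + E := by
    rw [(monic_X_pow k).natDegree_mul hm, natDegree_X_pow, hd]
  rw [weightedEval_mul_of_eq (w' := fun j => (nodeDeriv x j)⁻¹) (g := q),
    weightedEval_inv_nodeDeriv hx (by omega)]
  · split_ifs with h
    · have : N - 1 = (X ^ k * q).natDegree := by omega
      rw [this]
      exact (monic_X_pow k).mul hm
    · exact coeff_eq_zero_of_natDegree_lt (by omega)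
  · intro j
    rw [eval_mul]
    by_cases hj : j ∈ Set.range e
    · obtain ⟨s, rfl⟩ := hj
      have : q.eval (x (e s)) = 0 := by
        rw [hq, eval_prod]
        exact Finset.prod_eq_zero (Finset.mem_univ s) (by simp)
      simp [this]
    · rw [← hb j hj, mul_inv, mul_comm (y j)⁻¹, mul_assoc, inv_mul_cancel_left₀ (ha j)]

theorem det_vandermonde_sq (z : Fin E → K) :
    (Matrix.vandermonde z).det ^ 2 = ∏ s, ∏ t ∈ Finset.Ioi s, (z t - z s) ^ 2 := by
  rw [Matrix.det_vandermonde, ← Finset.prod_pow]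
  exact Finset.prod_congr rfl fun s _ => (Finset.prod_pow _ _ _).symm

theorem det_weightedEval_inv_corrupted {n r : ℕ} (hN : N = n + 2 * E + (r + 1))
    {x y : Fin N → K} (hx : Function.Injective x) {p : K[X]} (hp : p.natDegree = n)
    (hp₀ : p.leadingCoeff ≠ 0) {e : Fin E → Fin N} (he : Function.Injective e)
    (ha : ∀ j, y j ≠ 0) (hb : ∀ j, j ∉ Set.range e → y j = p.eval (x j))
    (hpx : ∀ j, p.eval (x j) ≠ 0) :
    (Matrix.of fun i j : Fin (n + E) =>
      weightedEval (fun j => (y j * nodeDeriv x j)⁻¹) x (X ^ (i : ℕ) * X ^ (j : ℕ))).det =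
      (-1) ^ (n * N + n * (n + 1) / 2 + E) * p.leadingCoeff ^ (r + 1) *
        (((∏ s, (y (e s) - p.eval (x (e s)))) *
            ∏ s, ∏ t ∈ Finset.Ioi s, (x (e t) - x (e s)) ^ 2) /
          ((∏ s, nodeDeriv x (e s)) * ∏ j, y j)) := by
  set w : Fin N → K := fun j => (y j * nodeDeriv x j)⁻¹ with hw
  set w₀ : Fin N → K := fun j => (p.eval (x j) * nodeDeriv x j)⁻¹ with hw₀
  have hW := nodeDeriv_ne_zero hx
  have hred : ∀ f, weightedEval w₀ x (f * p) =
      weightedEval (fun j => (nodeDeriv x j)⁻¹) x (f * 1) := fun f =>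
    weightedEval_mul_of_eq (fun j => by
      simp only [hw₀]
      rw [eval_one, mul_one, mul_inv, mul_comm _ (nodeDeriv x j)⁻¹, mul_assoc,
        inv_mul_cancel₀ (hpx j), mul_one]) f
  have h₁ := det_add_pointEvaluations (E := E) (L := weightedEval w x) (L₀ := weightedEval w₀ x)
    (δ := fun s => w (e s) - w₀ (e s)) (z := fun s => x (e s)) hp
    (by
      intro f
      rw [weightedEval_apply, weightedEval_apply, ← sub_eq_iff_eq_add', ← Finset.sum_sub_distrib]
      symm
      refine Fintype.sum_of_injective e he _ _ ?_ ?_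
      · intro j hj
        simp only [hw, hw₀, hb j hj, sub_self]
      · intro s
        rw [sub_mul])
    (by
      intro k hk
      rw [hred, mul_one, weightedEval_inv_nodeDeriv_X_pow hx (by omega), if_neg (by omega)])
    (by
      intro k l hk hl
      rw [← mul_assoc, hred, mul_one, mul_right_comm, ← pow_add, weightedEval_inv_nodeDeriv hx]
      · refine coeff_eq_zero_of_natDegree_lt (natDegree_mul_le.trans_lt ?_)
        rw [natDegree_X_pow]
        omega
      · refine natDegree_mul_le.trans_lt ?_
        rw [natDegree_X_pow]
        omega)
  rw [det_weightedEval_inv_eval (c := 2 * E + (r + 1)) (by omega) hx hp hpx] at h₁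
  -- From `1 / y - 1 / p = -(y - p) / (y p)`; the minus signs yield `(-1) ^ E`.
  have hδ : ∀ s, w (e s) - w₀ (e s) =
      (-1) * (y (e s) - p.eval (x (e s))) * (nodeDeriv x (e s))⁻¹ * (p.eval (x (e s)))⁻¹ *
        (y (e s))⁻¹ := by
    intro s
    have h₁ := hW (e s)
    have h₂ := ha (e s)
    have h₃ := hpx (e s)
    simp only [hw, hw₀]
    field_simp
    ring
  -- The ratio is `1` off the error positions. This trades the products over errors and the product
  -- of all `p(x_j)` for `∏ j, y j`.
  have hratio : ∏ s, (p.eval (x (e s)) * (y (e s))⁻¹) = ∏ j, (p.eval (x j) * (y j)⁻¹) :=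
    Fintype.prod_of_injective e he _ _
      (fun j hj => by rw [← hb j hj, mul_inv_cancel₀ (ha j)]) fun s => rfl
  -- With `m = N - n`, splitting `N (N - 1) / 2` produces `m (m - 1) / 2` twice, leaving `n (n - 1)
  -- / 2 + n m`. This has the parity of `n N + n (n + 1) / 2` since `n ^ 2 + n` is even.
  have hsign : (-1 : K) ^ (n * N + n * (n + 1) / 2 + E) =
      (-1) ^ (N * (N - 1) / 2) * (-1) ^ ((2 * E + (r + 1)) * (2 * E + (r + 1) - 1) / 2) *
        (-1) ^ E := by
    rw [← pow_add, ← pow_add]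
    apply neg_one_pow_eq_of_mod_two
    have hN' : N = n + (2 * E + (r + 1)) := by omega
    rw [hN', mul_pred_div_two_add, mul_add n n]
    have h₁ := mul_pred_div_two_add n 1
    have h₂ := Nat.even_iff.1 (Nat.even_mul_pred_self n)
    have h₃ : n * n = n * (n - 1) + n := by
      rcases n with _ | n
      · rfl
      · simp; ring
    simp only [Nat.add_sub_cancel, mul_comm (n + 1) n] at h₁
    omega
  rw [Finset.prod_congr rfl fun s _ => hδ s] at h₁
  simp only [Finset.prod_mul_distrib, Finset.prod_inv_distrib, Finset.prod_const, Finset.card_univ,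
    Fintype.card_fin] at h₁ hratio
  rw [det_vandermonde_sq] at h₁
  have hPe : ∏ s, p.eval (x (e s)) ≠ 0 := Finset.prod_ne_zero_iff.2 fun s _ => hpx _
  have hP : ∏ j, p.eval (x j) ≠ 0 := Finset.prod_ne_zero_iff.2 fun s _ => hpx _
  have hYe : ∏ s, y (e s) ≠ 0 := Finset.prod_ne_zero_iff.2 fun s _ => ha _
  have hY : ∏ j, y j ≠ 0 := Finset.prod_ne_zero_iff.2 fun s _ => ha _
  have hWe : ∏ s, nodeDeriv x (e s) ≠ 0 := Finset.prod_ne_zero_iff.2 fun s _ => hW _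
  refine mul_right_cancel₀ (pow_ne_zero (2 * E) hp₀) (h₁.trans ?_)
  rw [hsign, add_comm (2 * E), pow_add p.leadingCoeff]
  generalize (-1 : K) ^ (N * (N - 1) / 2) = s₁
  generalize (-1 : K) ^ ((r + 1 + 2 * E) * (r + 1 + 2 * E - 1) / 2) = s₂
  have hYe' : (∏ s, y (e s))⁻¹ =
      (∏ s, p.eval (x (e s)))⁻¹ * ((∏ j, p.eval (x j)) * (∏ j, y j)⁻¹) := by
    rw [← hratio, inv_mul_cancel_left₀ hPe]
  rw [hYe']
  field_simp

end ErrorLocator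

/-! ### The three Hankel identities. -/

theorem theorem4p3 {K : Type*} [Field K] (N E n : ℕ)
    (hE : 2 ≤ E) (hEN : E ≤ N / 2 - 1)
    (x y : Fin N → K) (hx : Function.Injective x)
    (p : K[X]) (hp : p.degree = (n : WithBot ℕ)) (hn : n < N - 2 * E)
    (e : Fin E → Fin N) (he : Function.Injective e)
    (ha : ∀ j, y j ≠ 0)
    (hb : ∀ j, j ∉ Set.range e → y j = p.eval (x j))
    (hc : ∀ s, p.eval (x (e s)) ≠ y (e s) ∧ p.eval (x (e s)) ≠ 0) :
    hankelPoly (tauTilde x y) (n + E) =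
        C ((-1) ^ (n * N + n * (n + 1) / 2 + E) * p.leadingCoeff ^ (N - n - 2 * E - 1) *
            (((∏ s, (y (e s) - p.eval (x (e s)))) *
                ∏ s, ∏ t ∈ Finset.Ioi s, (x (e t) - x (e s)) ^ 2) /
              ((∏ s, nodeDeriv x (e s)) * ∏ j, y j))) *
          (p * ∏ s, (X - C (x (e s)))) ∧
      (n < N - 2 * E - 1 →
        hankelPoly (tauTilde x y) (N - E - 1) =
          C ((-1) ^ (E + (N - n) * (N - n - 1) / 2) / p.leadingCoeff ^ (N - n - 2 * E - 1)) *
            hankelPoly (tauTilde x y) (n + E)) ∧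
      (n < N - 2 * E - 2 →
        ∀ k, n + E + 1 ≤ k → k ≤ N - E - 2 → hankelPoly (tauTilde x y) k = 0) := by
  -- The orders in question are `n + E + c` with `0 ≤ c ≤ r`, and `n + E + r = N - E - 1`.
  obtain ⟨r, hr⟩ : ∃ r, N = n + 2 * E + (r + 1) := ⟨N - n - 2 * E - 1, by omega⟩
  have hpx : ∀ j, p.eval (x j) ≠ 0 := by
    intro j
    by_cases hj : j ∈ Set.range e
    · obtain ⟨s, rfl⟩ := hj
      exact (hc s).2
    · rw [← hb j hj]
      exact ha j
  have hp₀ : p.leadingCoeff ≠ 0 := by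
    rw [leadingCoeff_ne_zero]
    rintro rfl
    simp at hp
  have hpn : p.natDegree = n := natDegree_eq_of_degree_eq_some hp
  have hm := monic_prod_X_sub_C (fun s => x (e s)) Finset.univ
  have hmoment := fun k (hk : k + E < N) => weightedEval_X_pow_mul_locator hx ha hb hk
  have hdeg : (p * ∏ s, (X - C (x (e s)))).natDegree = n + E := by
    rw [natDegree_mul (leadingCoeff_ne_zero.1 hp₀) hm.ne_zero, hpn,
      natDegree_prod_X_sub_C fun s => x (e s)]
  have hlead : (p * ∏ s, (X - C (x (e s)))).leadingCoeff = p.leadingCoeff :=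
    leadingCoeff_mul_monic hm
  have hH : ∀ c ≤ r, hankelPoly (tauTilde x y) (n + E + c) * C (p.leadingCoeff ^ (c + 1)) =
      C ((Matrix.of fun i j : Fin (n + E) =>
        weightedEval (fun j => (y j * nodeDeriv x j)⁻¹) x (X ^ (i : ℕ) * X ^ (j : ℕ))).det *
          ((-1) ^ ((c + 1) * c / 2) *
            weightedEval (fun j => (y j * nodeDeriv x j)⁻¹) x
              (X ^ (n + E + c) * (p * ∏ s, (X - C (x (e s))))) ^ c)) *
        (p * ∏ s, (X - C (x (e s)))) := by
    intro c hc
    rw [← hlead]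
    exact hankelPoly_mul_leadingCoeff_pow (c := c) (tauTilde_eq x y) hdeg fun k hk => by
      rw [hmoment k (by omega), if_neg (by omega)]
  have hC : ∀ c, (C (p.leadingCoeff ^ c) : K[X]) ≠ 0 := fun c => C_ne_zero.2 (pow_ne_zero c hp₀)
  -- For `c = 0` the moment enters with exponent `0`, so its value is immaterial.
  have hH₀ := hH 0 (Nat.zero_le r)
  simp only [zero_add, add_zero, pow_one, pow_zero, mul_one, mul_zero, Nat.zero_div] at hH₀
  have hexp : N - n - 2 * E - 1 = r := by omega
  rw [hexp]
  refine ⟨?_, fun _ => ?_, fun _ k hk₁ hk₂ => ?_⟩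
  · refine mul_right_cancel₀ (C_ne_zero.2 hp₀) (hH₀.trans ?_)
    rw [det_weightedEval_inv_corrupted hr hx hpn hp₀ he ha hb hpx, mul_right_comm (C _), ← C_mul]
    congr 2
    ring
  · have hk : N - E - 1 = n + E + r := by omega
    -- As `N - n = 2E + (r + 1)`, the triangular number contributes `E (2E - 1)`, which cancels `E`
    -- modulo `2`.
    have hsign : (-1 : K) ^ (E + (N - n) * (N - n - 1) / 2) = (-1) ^ ((r + 1) * r / 2) := by
      apply neg_one_pow_eq_of_mod_two
      have hN : N - n = 2 * E + (r + 1) := by omega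
      have h₁ : (2 * E) * (2 * E - 1) / 2 = E * (2 * E - 1) := by
        rw [mul_assoc, Nat.mul_div_cancel_left _ two_pos]
      have h₂ : E * (2 * E - 1) + E = 2 * (E * E) := by
        obtain ⟨m, rfl⟩ : ∃ m, E = m + 1 := ⟨E - 1, by omega⟩
        have : 2 * (m + 1) - 1 = 2 * m + 1 := by omega
        rw [this]
        ring
      rw [hN, mul_pred_div_two_add, h₁, Nat.add_sub_cancel, mul_assoc 2 E]
      omega
    have hHr := hH r le_rfl
    rw [hmoment (n + E + r) (by omega), if_pos (by omega), one_pow, mul_one] at hHr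
    rw [hk, hsign]
    refine mul_right_cancel₀ (hC (r + 1)) (hHr.trans ?_)
    have h₁ : (C (p.leadingCoeff ^ (r + 1)) : K[X]) =
        C (p.leadingCoeff ^ r) * C p.leadingCoeff := by rw [← C_mul, pow_succ]
    rw [h₁, mul_mul_mul_comm, hH₀, ← C_mul, div_mul_cancel₀ _ (pow_ne_zero r hp₀), C_mul]
    ring
  -- Strictly between the extreme orders the moment is `0` and its exponent `c + 1` is positive.
  · obtain ⟨c, rfl⟩ : ∃ c, k = n + E + (c + 1) := ⟨k - (n + E) - 1, by omega⟩
    have hHc := hH (c + 1) (by omega)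
    rw [hmoment (n + E + (c + 1)) (by omega), if_neg (by omega), zero_pow c.succ_ne_zero, mul_zero,
      mul_zero, C_0, zero_mul] at hHc
    exact (mul_eq_zero.1 hHc).resolve_right (hC _)
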